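/- An \emph{online Turing machine} is a deterministic Turing machine with finitely many states, a read-only input tape whose head can stay or move to the right but never to the left, and a read-write working tape over a finite alphabet, infinite in both directions and initially blank. The input is followed by an end mark, which the input head does not leave. A machine \emph{with shifted input} receives a word $w$ of length $n$ over a finite alphabet $\Sigma$ (which does not contain the empty symbol or the end mark) as the tape content that consists of $n$ empty squares followed by $w$; it starts on the first of these $2n$ squares. It \emph{recognizes} $L\subseteq\Sigma^*$ if, for every $w\in\Sigma^*$, it halts in an accepting state on $w$ exactly when $w\in L$. It \emph{uses at most $f(n)$ memory} if, for every $n$ and every input word of length $n$, its working head visits at most $f(n)$ squares of the working tape. Let $\mathrm{1DSPACE}'(f)$ be the class of languages recognized by online Turing machines with shifted input that use at most $f(n)$ memory, and let $\mathrm{1DSPACE}'(o(\log))$ be the union of the classes $\mathrm{1DSPACE}'(f)$ over all $f:\mathbb{N}\to\mathbb{R}$ with $f(n)=o(\log n)$ as $n\to\infty$. \textbf{Lemma.} Over every finite alphabet, $\mathrm{1DSPACE}'(o(\log)) = \mathrm{REG}$, the class of regular languages. -/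

import Mathlib

/-- The possible contents of a scanned square of the input tape: an empty square, a letter of the
input alphabet, or the mark behind the last square of the input. -/
inductive InputSymbol (α : Type*) where
  | empty : InputSymbol α
  | letter (a : α) : InputSymbol α
  | endMark : InputSymbol α

/-- A deterministic online Turing machine over the input alphabet `α`: it has a read-only input
tape whose head never moves to the left, and one read-write working tape, infinite in both
directions.

`step q x g` describes the step taken in state `q` when the input head scans `x` and the working
head scans `g`; it is `none` when the machine halts. Otherwise it gives the new state, the symbol
written on the working tape, the shift (`-1`, `0` or `1`) of the working head, and whether the
input head advances by one square (`true`) or stays (`false`). -/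
structure OnlineTM (α : Type*) where
  State : Type
  [finiteState : Finite State]
  WorkSymbol : Type
  [finiteWorkSymbol : Finite WorkSymbol]
  blank : WorkSymbol
  start : State
  accepting : Set State
  step : State → InputSymbol α → WorkSymbol → Option (State × WorkSymbol × SignType × Bool)

namespace OnlineTM

variable {α : Type*}

/-- A configuration of an online Turing machine. As the input head only moves to the right, the
input tape is represented by the part `rest` that starts at the scanned square. The entry `none`
is an empty square. When `rest` is exhausted, the head scans the end mark. -/
structure Config (M : OnlineTM α) where
  state : M.State
  work : ℤ → M.WorkSymbol
  head : ℤ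
  rest : List (Option α)

/-- The symbol scanned by the input head. -/
def scanned : List (Option α) → InputSymbol α
  | [] => InputSymbol.endMark
  | none :: _ => InputSymbol.empty
  | some a :: _ => InputSymbol.letter a

/-- One step of the computation; `none` if the machine halts. -/
def next (M : OnlineTM α) (c : M.Config) : Option M.Config :=
  (M.step c.state (scanned c.rest) (c.work c.head)).map fun r =>
    { state := r.1
      work := Function.update c.work c.head r.2.1
      head := c.head + (r.2.2.1 : ℤ)
      rest := if r.2.2.2 then c.rest.tail else c.rest }

/-- The initial configuration on a given content of the input tape. -/
def init (M : OnlineTM α) (tape : List (Option α)) : M.Config where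
  state := M.start
  work := fun _ => M.blank
  head := 0
  rest := tape

/-- The machine accepts if it halts in an accepting state. -/
def Accepts (M : OnlineTM α) (tape : List (Option α)) : Prop :=
  ∃ c : M.Config, StateTransition.Reaches M.next (M.init tape) c ∧
    M.next c = none ∧ c.state ∈ M.accepting

/-- The squares of the working tape that the working head visits during the computation. -/
def visited (M : OnlineTM α) (tape : List (Option α)) : Set ℤ :=
  {z | ∃ c : M.Config, StateTransition.Reaches M.next (M.init tape) c ∧ c.head = z}

/-- The computation on the given input tape visits at most `s` squares of the working tape. -/
def UsesAtMost (M : OnlineTM α) (tape : List (Option α)) (s : ℝ) : Prop :=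
  (M.visited tape).Finite ∧ ((M.visited tape).ncard : ℝ) ≤ s

end OnlineTM

/-- The input tape for a machine with shifted input: the word `w` is preceded by as many empty
squares as it has letters. -/
def shiftedInput {α : Type*} (w : List α) : List (Option α) :=
  List.replicate w.length none ++ w.map some

/-- The class `1DSPACE'(f)`: languages recognized by an online Turing machine with shifted input
that uses at most `f n` squares of memory on every input word of length `n`. -/
def OneDSpaceShifted (α : Type*) (f : ℕ → ℝ) : Set (Language α) :=
  {L | ∃ M : OnlineTM α, ∀ w : List α,
    (w ∈ L ↔ M.Accepts (shiftedInput w)) ∧ M.UsesAtMost (shiftedInput w) (f w.length)}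

/-- The class `1DSPACE'(o(g))`: the union of the classes `1DSPACE'(f)` over all `f = o(g)`. -/
def OneDSpaceShiftedLittleO (α : Type*) (g : ℕ → ℝ) : Set (Language α) :=
  {L | ∃ f : ℕ → ℝ, Asymptotics.IsLittleO Filter.atTop f g ∧ L ∈ OneDSpaceShifted α f}

/-! What a machine remembers of a tape prefix is a left quotient of `tapeLanguage`: it is fixed by
the configuration in which the input head leaves the prefix, and is trivial if the head never
leaves. With memory o(log n), the prefixes of shifted inputs of length n therefore yield, for large
n, fewer than n/2 quotients. By pigeonhole, both the word read after n empty squares and the block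
of empty squares itself can be pumped down, so the quotient of (n, u) with |u| ≤ n also arises from
a smaller shift (`exists_lt_shiftedQuotient_eq`). By descent only finitely many quotients occur for
all n together (`finite_setOf_shiftedQuotient`). Myhill–Nerode then gives regularity
(`isRegular_of_finite_shiftedQuotient`), and conversely a finite automaton is a machine visiting one
work square. -/

theorem exists_lt_le_eq_of_mapsTo {β : Type*} {P : Set β} (hP : P.Finite) (g : ℕ → β) {m : ℕ}
    (hm : P.ncard ≤ m) (hg : ∀ i ≤ m, g i ∈ P) : ∃ i j, i < j ∧ j ≤ m ∧ g i = g j := by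
  have hcard : hP.toFinset.card < (Finset.range (m + 1)).card := by
    rw [Finset.card_range, ← Set.ncard_eq_toFinset_card P hP]; omega
  obtain ⟨i, hi, j, hj, hij, h⟩ := Finset.exists_ne_map_eq_of_card_lt_of_maps_to hcard
    (f := g) (fun i hi => by
      have : i ≤ m := by simpa [Nat.lt_succ_iff] using hi
      simpa using hg i this)
  simp only [Finset.mem_range] at hi hj
  rcases lt_or_gt_of_ne hij with h' | h'
  · exact ⟨i, j, h', by omega, h⟩
  · exact ⟨j, i, h', by omega, h.symm⟩

/-! ### Quotients by shifted prefixes -/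

namespace Language

variable {α : Type*}

/-- The left quotient by the content of a tape on which `n` empty squares precede the word `u`. -/
def shiftedQuotient (T : Language (Option α)) (n : ℕ) (u : List α) : Language (Option α) :=
  T.leftQuotient (List.replicate n none ++ u.map some)

theorem shiftedQuotient_append (T : Language (Option α)) (n : ℕ) (u v : List α) :
    T.shiftedQuotient n (u ++ v) = (T.shiftedQuotient n u).leftQuotient (v.map some) := by
  simp [shiftedQuotient, ← leftQuotient_append]

theorem shiftedQuotient_eq (T : Language (Option α)) (n : ℕ) (u : List α) :
    T.shiftedQuotient n u = (T.shiftedQuotient n []).leftQuotient (u.map some) := by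
  rw [← shiftedQuotient_append, List.nil_append]

theorem shiftedQuotient_add_nil (T : Language (Option α)) (m n : ℕ) :
    T.shiftedQuotient (m + n) [] =
      (T.shiftedQuotient m []).leftQuotient (List.replicate n none) := by
  simp [shiftedQuotient, ← leftQuotient_append]

/-- If few quotients occur, then the word can be shortened without changing the quotient. -/
theorem exists_short_shiftedQuotient_eq {T : Language (Option α)} {n : ℕ}
    {P : Set (Language (Option α))} (hP : P.Finite)
    (hu : ∀ u : List α, u.length ≤ n → T.shiftedQuotient n u ∈ P) (u : List α)
    (hun : u.length ≤ n) :
    ∃ v : List α, v.length ≤ P.ncard ∧ T.shiftedQuotient n u = T.shiftedQuotient n v := by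
  induction hl : u.length using Nat.strong_induction_on generalizing u with
  | _ l ih =>
    subst hl
    by_cases hlen : u.length ≤ P.ncard
    · exact ⟨u, hlen, rfl⟩
    obtain ⟨i, j, hij, hj, h⟩ := exists_lt_le_eq_of_mapsTo hP
      (fun i => T.shiftedQuotient n (u.take i)) (m := u.length) (by omega)
      (fun i hi => hu _ (by simp; omega))
    have hlt : (u.take i ++ u.drop j).length < u.length := by simp; omega
    obtain ⟨v, hv, hv'⟩ := ih _ hlt _ (by omega) rfl
    refine ⟨v, hv, ?_⟩
    rw [← hv', shiftedQuotient_append, h, ← shiftedQuotient_append, List.take_append_drop]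

/-- If few quotients occur, then the shift can be shortened without changing the quotient. -/
theorem exists_lt_shiftedQuotient_eq {T : Language (Option α)} {n : ℕ}
    {P : Set (Language (Option α))} (hP : P.Finite) (hcard : 2 * P.ncard < n)
    (hu : ∀ u : List α, u.length ≤ n → T.shiftedQuotient n u ∈ P)
    (hk : ∀ k ≤ n, T.shiftedQuotient k [] ∈ P) (u : List α) (hun : u.length ≤ n) :
    ∃ m < n, ∃ v : List α, v.length ≤ m ∧ T.shiftedQuotient n u = T.shiftedQuotient m v := by
  obtain ⟨v, hv, huv⟩ := exists_short_shiftedQuotient_eq hP hu u hun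
  obtain ⟨i, j, hij, hj, h⟩ := exists_lt_le_eq_of_mapsTo hP
    (fun k => T.shiftedQuotient k []) le_rfl (fun k _ => hk k (by omega))
  -- Empty squares `i` to `j` are cut out. Since `j ≤ P.ncard` and `2 * P.ncard < n`, at least
  -- `P.ncard` squares remain, enough for `v`.
  refine ⟨i + (n - j), by omega, v, by omega, ?_⟩
  have hn : T.shiftedQuotient n [] = T.shiftedQuotient (i + (n - j)) [] := by
    rw [shiftedQuotient_add_nil, h, ← shiftedQuotient_add_nil, Nat.add_sub_cancel' (by omega)]
  rw [huv, shiftedQuotient_eq, hn, ← shiftedQuotient_eq]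

/-- Descent on the shift: every quotient already arises from a shift below `n₀`, where there are
finitely many words. -/
theorem finite_setOf_shiftedQuotient [Finite α] {T : Language (Option α)} {n₀ : ℕ}
    (hT : ∀ n ≥ n₀, ∃ P : Set (Language (Option α)), P.Finite ∧ 2 * P.ncard < n ∧
      (∀ u : List α, u.length ≤ n → T.shiftedQuotient n u ∈ P) ∧
      ∀ k ≤ n, T.shiftedQuotient k [] ∈ P) :
    {q | ∃ (n : ℕ) (u : List α), u.length ≤ n ∧ T.shiftedQuotient n u = q}.Finite := by
  have hfin : (⋃ n ∈ Set.Iio n₀,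
      T.shiftedQuotient n '' {u : List α | u.length ≤ n}).Finite :=
    (Set.finite_Iio n₀).biUnion fun n _ => (List.finite_length_le α n).image _
  refine hfin.subset ?_
  rintro q ⟨n, u, hun, rfl⟩
  induction n using Nat.strong_induction_on generalizing u with
  | _ n ih =>
    by_cases hn : n < n₀
    · exact Set.mem_biUnion (Set.mem_Iio.2 hn) ⟨u, hun, rfl⟩
    · obtain ⟨P, hP, hcard, hu, hk⟩ := hT n (by omega)
      obtain ⟨m, hm, v, hv, h⟩ := exists_lt_shiftedQuotient_eq hP hcard hu hk u hun
      rw [h]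
      exact ih m hm v hv

/-- If only finitely many left quotients of `T` arise from shifted prefixes, then the words whose
shifted input belongs to `T` form a regular language. -/
theorem isRegular_of_finite_shiftedQuotient {T : Language (Option α)} {L : Language α}
    (hL : ∀ w, w ∈ L ↔ shiftedInput w ∈ T)
    (hR : {q | ∃ (n : ℕ) (u : List α), u.length ≤ n ∧ T.shiftedQuotient n u = q}.Finite) :
    L.IsRegular := by
  classical
  rw [isRegular_iff_finite_range_leftQuotient]
  set R := {q | ∃ (n : ℕ) (u : List α), u.length ≤ n ∧ T.shiftedQuotient n u = q} with hRdef
  have : Finite R := hR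
  have hfin : (R ×ˢ {F : R → Language (Option α) | ∀ r, F r ∈ insert ⊥ R}).Finite :=
    hR.prod (Set.Finite.pi' fun _ => hR.insert ⊥)
  -- A residual of `L` by `u` is recovered from the quotient after |u| empty squares and the action
  -- of `u` on `R`: a continuation `v` first contributes its |v| further empty squares, then `u`
  -- acts, then `v` is read.
  let Ψ : Language (Option α) × (R → Language (Option α)) → Language α := fun p =>
    {v | ∃ h : p.1.leftQuotient (List.replicate v.length none) ∈ R, v.map some ∈ p.2 ⟨_, h⟩}
  refine (hfin.image Ψ).subset ?_
  rintro _ ⟨u, rfl⟩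
  -- The action of `u`; the default `⊥` covers those `r` for which the quotient by `u` need not lie
  -- in `R`.
  let F : R → Language (Option α) := fun r =>
    if ∃ n, u.length ≤ n ∧ T.shiftedQuotient n [] = r then r.1.leftQuotient (u.map some) else ⊥
  refine ⟨(T.shiftedQuotient u.length [], F), ⟨⟨_, [], by simp, rfl⟩, fun r => ?_⟩, ?_⟩
  · by_cases h : ∃ n, u.length ≤ n ∧ T.shiftedQuotient n [] = r
    · simp only [F, if_pos h]
      obtain ⟨n, hn, hr⟩ := h
      exact Or.inr ⟨n, u, hn, by rw [shiftedQuotient_eq, hr]⟩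
    · simp only [F, if_neg h]
      exact Or.inl rfl
  · ext v
    have key : (T.shiftedQuotient u.length []).leftQuotient (List.replicate v.length none) =
        T.shiftedQuotient (u.length + v.length) [] := (shiftedQuotient_add_nil ..).symm
    have hmem : (T.shiftedQuotient u.length []).leftQuotient (List.replicate v.length none) ∈ R :=
      ⟨u.length + v.length, [], by simp, key.symm⟩
    have hF : F ⟨_, hmem⟩ = T.shiftedQuotient (u.length + v.length) u := by
      have h : ∃ n, u.length ≤ n ∧ T.shiftedQuotient n [] =
          (T.shiftedQuotient u.length []).leftQuotient (List.replicate v.length none) :=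
        ⟨u.length + v.length, by omega, key.symm⟩
      simp only [F, if_pos h]
      rw [key, ← shiftedQuotient_eq]
    have hv : v ∈ L.leftQuotient u ↔ v.map some ∈ T.shiftedQuotient (u.length + v.length) u := by
      rw [mem_leftQuotient, hL]
      simp [shiftedQuotient, shiftedInput]
    rw [hv, ← hF]
    exact ⟨fun ⟨_, h⟩ => h, fun h => ⟨hmem, h⟩⟩

end Language

/-! ### Quotients of the tape language and configurations -/

namespace OnlineTM

variable {α : Type*} {M : OnlineTM α}

open StateTransition

/-- The configuration `c` with the unread part of the input tape replaced. -/
def Config.withRest (c : M.Config) (t : List (Option α)) : M.Config := { c with rest := t }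

/-- The contents of the unread part of the input tape on which the machine accepts, started in the
configuration `c`. -/
def Config.language (c : M.Config) : Language (Option α) :=
  {t | ∃ d : M.Config, Reaches M.next (c.withRest t) d ∧ M.next d = none ∧ d.state ∈ M.accepting}

theorem accepts_iff_of_reaches {c d : M.Config} (h : Reaches M.next c d) :
    (∃ e, Reaches M.next c e ∧ M.next e = none ∧ e.state ∈ M.accepting) ↔
      ∃ e, Reaches M.next d e ∧ M.next e = none ∧ e.state ∈ M.accepting := by
  constructor
  · rintro ⟨e, he, hn, ha⟩
    refine ⟨e, ?_, hn, ha⟩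
    rcases reaches_total h he with h' | h'
    · exact h'
    · rcases Relation.ReflTransGen.cases_head h' with rfl | ⟨x, hx, -⟩
      · exact Relation.ReflTransGen.refl
      · rw [hn] at hx; cases hx
  · rintro ⟨e, he, hn, ha⟩
    exact ⟨e, h.trans he, hn, ha⟩

theorem next_withRest_cons (c : M.Config) (x : Option α) :
    (∀ v, M.next (c.withRest (x :: v)) = none) ∨
      (∃ d : M.Config, ∀ v, M.next (c.withRest (x :: v)) = some (d.withRest v)) ∨
      ∃ d : M.Config, ∀ v, M.next (c.withRest (x :: v)) = some (d.withRest (x :: v)) := by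
  have hs : ∀ v, scanned (x :: v) = scanned [x] := by cases x <;> simp [scanned]
  rcases h : M.step c.state (scanned [x]) (c.work c.head) with _ | ⟨q, g, m, b⟩
  · left
    intro v
    simp [next, Config.withRest, hs v, h]
  · right
    cases b
    · right
      exact ⟨⟨q, Function.update c.work c.head g, c.head + (m : ℤ), []⟩, fun v => by
        simp [next, Config.withRest, hs v, h]⟩
    · left
      exact ⟨⟨q, Function.update c.work c.head g, c.head + (m : ℤ), []⟩, fun v => by
        simp [next, Config.withRest, hs v, h]⟩

/-- On a single square, the machine either proceeds to the next square, or it accepts or does not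
accept independently of the further content of the tape. -/
theorem reaches_or_const_cons (c : M.Config) (x : Option α) :
    (∃ d : M.Config, ∀ v, Reaches M.next (c.withRest (x :: v)) (d.withRest v)) ∨
      (∀ v, x :: v ∈ c.language) ∨ ∀ v, x :: v ∉ c.language := by
  by_cases h : ∃ d : M.Config, (∀ v, Reaches M.next (c.withRest (x :: v)) (d.withRest (x :: v))) ∧
      ¬ ∃ e : M.Config, ∀ v, M.next (d.withRest (x :: v)) = some (e.withRest (x :: v))
  -- `d` is the last configuration on this square: there the machine halts or moves on.
  · obtain ⟨d, hd, hd_last⟩ := h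
    rcases next_withRest_cons d x with hn | ⟨e, he⟩ | he
    · right
      by_cases ha : d.state ∈ M.accepting
      · exact Or.inl fun v => ⟨_, hd v, hn v, ha⟩
      · refine Or.inr fun v hv => ?_
        obtain ⟨e, he, -, hea⟩ := (accepts_iff_of_reaches (hd v)).1 hv
        rcases Relation.ReflTransGen.cases_head he with rfl | ⟨y, hy, -⟩
        · exact ha hea
        · rw [hn v] at hy; cases hy
    · exact Or.inl ⟨e, fun v => (hd v).tail (he v)⟩
    · exact absurd he hd_last
  -- Otherwise the machine stays on the square forever, so it never halts.
  · push Not at h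
    refine Or.inr (Or.inr fun v hv => ?_)
    obtain ⟨e, he, hn, -⟩ := hv
    have key : ∃ d : M.Config, e = d.withRest (x :: v) ∧
        ∀ v, Reaches M.next (c.withRest (x :: v)) (d.withRest (x :: v)) := by
      clear hn
      induction he with
      | refl => exact ⟨c, rfl, fun _ => Relation.ReflTransGen.refl⟩
      | tail _ hstep ih =>
        obtain ⟨d, rfl, hd⟩ := ih
        obtain ⟨d', hd'⟩ := h d hd
        rw [hd' v] at hstep
        cases hstep
        exact ⟨d', rfl, fun v => (hd v).tail (hd' v)⟩
    obtain ⟨d, rfl, hd⟩ := key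
    obtain ⟨d', hd'⟩ := h d hd
    rw [hd' v] at hn
    cases hn

theorem reaches_or_const_append (t : List (Option α)) (c : M.Config) :
    (∃ d : M.Config, ∀ v, Reaches M.next (c.withRest (t ++ v)) (d.withRest v)) ∨
      (∀ v, t ++ v ∈ c.language) ∨ ∀ v, t ++ v ∉ c.language := by
  induction t generalizing c with
  | nil => exact Or.inl ⟨c, fun _ => Relation.ReflTransGen.refl⟩
  | cons x t ih =>
    rcases reaches_or_const_cons c x with ⟨d, hd⟩ | h | h
    · have hiff : ∀ v, x :: v ∈ c.language ↔ v ∈ d.language := fun v =>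
        accepts_iff_of_reaches (hd v)
      rcases ih d with ⟨e, he⟩ | h | h
      · exact Or.inl ⟨e, fun v => (hd (t ++ v)).trans (he v)⟩
      · exact Or.inr (Or.inl fun v => (hiff _).2 (h v))
      · exact Or.inr (Or.inr fun v => mt (hiff _).1 (h v))
    · exact Or.inr (Or.inl fun v => h _)
    · exact Or.inr (Or.inr fun v => h _)

/-- The language of the input tapes that the machine accepts. -/
def tapeLanguage (M : OnlineTM α) : Language (Option α) := {t | M.Accepts t}

theorem leftQuotient_tapeLanguage (M : OnlineTM α) (t v : List (Option α)) :
    (∃ d : M.Config, Reaches M.next (M.init (t ++ v)) (d.withRest v) ∧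
      M.tapeLanguage.leftQuotient t = d.language) ∨
      M.tapeLanguage.leftQuotient t = ⊤ ∨ M.tapeLanguage.leftQuotient t = ⊥ := by
  rcases reaches_or_const_append t (M.init []) with ⟨d, hd⟩ | h | h
  · refine Or.inl ⟨d, hd v, ?_⟩
    ext v
    exact accepts_iff_of_reaches (hd v)
  · refine Or.inr (Or.inl ?_)
    ext v
    exact iff_of_true (h v) trivial
  · refine Or.inr (Or.inr ?_)
    ext v
    exact iff_of_false (h v) (fun h => h)

theorem exists_head_eq_of_mem_uIcc {c d : M.Config} (h : Reaches M.next c d) {z : ℤ}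
    (hz : z ∈ Set.uIcc c.head d.head) : ∃ e, Reaches M.next c e ∧ e.head = z := by
  induction h with
  | refl =>
    rw [Set.uIcc_self, Set.mem_singleton_iff] at hz
    exact ⟨c, Relation.ReflTransGen.refl, hz.symm⟩
  | @tail d e hcd hde ih =>
    by_cases hz' : z ∈ Set.uIcc c.head d.head
    · exact ih hz'
    · refine ⟨e, hcd.tail hde, ?_⟩
      have hstep : e.head - d.head ∈ Set.Icc (-1 : ℤ) 1 := by
        rw [Option.mem_def, next, Option.map_eq_some_iff] at hde
        obtain ⟨⟨q, g, m, b⟩, -, rfl⟩ := hde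
        cases m <;> simp
      simp only [Set.mem_uIcc, Set.mem_Icc] at hz hz' hstep
      omega

theorem work_eq_blank {t : List (Option α)} {c : M.Config} (h : Reaches M.next (M.init t) c)
    {z : ℤ} (hz : z ∉ M.visited t) : c.work z = M.blank := by
  induction h with
  | refl => rfl
  | @tail d e hd hde ih =>
    rw [Option.mem_def, next, Option.map_eq_some_iff] at hde
    obtain ⟨r, -, rfl⟩ := hde
    have hne : z ≠ d.head := fun h => hz ⟨d, hd, h.symm⟩
    simpa [Function.update_of_ne hne] using ih

/-- The working head moves by at most one square, so the visited squares form an interval around 0.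
-/
theorem visited_subset_Icc {t : List (Option α)} (hfin : (M.visited t).Finite) :
    M.visited t ⊆ Set.Icc (-(M.visited t).ncard : ℤ) (M.visited t).ncard := by
  rintro z ⟨c, hc, rfl⟩
  have hsub : Set.uIcc 0 c.head ⊆ M.visited t := fun y hy => exists_head_eq_of_mem_uIcc hc hy
  have hle := Set.ncard_le_ncard hsub hfin
  rw [← Finset.coe_uIcc, Set.ncard_coe_finset, Int.card_uIcc] at hle
  simp only [Set.mem_Icc]
  omega

/-- The languages of the configurations that use the squares from `-s` to `s` only, and the two
trivial languages. -/
def boundedLanguages (M : OnlineTM α) (s : ℕ) : Set (Language (Option α)) :=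
  Config.language '' {c : M.Config | c.rest = [] ∧ c.head ∈ Set.Icc (-s : ℤ) s ∧
    ∀ z ∉ Set.Icc (-s : ℤ) s, c.work z = M.blank} ∪ {⊤, ⊥}

theorem boundedLanguages_mono (M : OnlineTM α) : Monotone M.boundedLanguages := by
  intro s s' hs
  refine Set.union_subset_union_left _ (Set.image_mono ?_)
  rintro c ⟨hr, hh, hw⟩
  have hsub : Set.Icc (-s : ℤ) s ⊆ Set.Icc (-s' : ℤ) s' :=
    Set.Icc_subset_Icc (by omega) (by omega)
  exact ⟨hr, hsub hh, fun z hz => hw z fun h => hz (hsub h)⟩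

/-- The quotient does not depend on `v`, so a memory bound for a single continuation suffices. -/
theorem leftQuotient_mem_boundedLanguages {t v : List (Option α)}
    (hfin : (M.visited (t ++ v)).Finite) :
    M.tapeLanguage.leftQuotient t ∈ M.boundedLanguages (M.visited (t ++ v)).ncard := by
  rcases leftQuotient_tapeLanguage M t v with ⟨d, hd, h⟩ | h
  · rw [h]
    refine Or.inl ⟨d.withRest [], ⟨rfl, visited_subset_Icc hfin ⟨_, hd, rfl⟩, fun z hz => ?_⟩, rfl⟩
    exact work_eq_blank hd fun hz' => hz (visited_subset_Icc hfin hz')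
  · exact Or.inr h

theorem boundedLanguages_finite_ncard_le (M : OnlineTM α) (s : ℕ) :
    (M.boundedLanguages s).Finite ∧ (M.boundedLanguages s).ncard ≤
      Nat.card M.State * (2 * s + 1) * Nat.card M.WorkSymbol ^ (2 * s + 1) + 2 := by
  classical
  have := M.finiteState
  have := M.finiteWorkSymbol
  let I := Set.Icc (-s : ℤ) s
  let Φ : M.State × I × (I → M.WorkSymbol) → Language (Option α) := fun p =>
    Config.language (M := M) ⟨p.1, fun z => if h : z ∈ I then p.2.2 ⟨z, h⟩ else M.blank, p.2.1, []⟩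
  have hsub : M.boundedLanguages s ⊆ Set.range Φ ∪ {⊤, ⊥} := by
    refine Set.union_subset_union_left _ ?_
    rintro _ ⟨c, ⟨hr, hh, hw⟩, rfl⟩
    refine ⟨(c.state, ⟨c.head, hh⟩, fun z => c.work z), ?_⟩
    obtain ⟨q, w, h, r⟩ := c
    dsimp only at hr hh hw
    subst hr
    have hwork : (fun z => if z ∈ I then w z else M.blank) = w := by
      funext z
      split_ifs with hz
      · rfl
      · exact (hw z hz).symm
    simp [Φ, hwork]
  have hfin : (Set.range Φ ∪ {⊤, ⊥}).Finite := (Set.finite_range Φ).union (Set.toFinite _)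
  refine ⟨hfin.subset hsub, (Set.ncard_le_ncard hsub hfin).trans ((Set.ncard_union_le _ _).trans ?_)⟩
  have hI : Nat.card I = 2 * s + 1 := by
    simp only [I, Nat.card_eq_fintype_card, Fintype.card_ofFinset, Int.card_Icc]
    omega
  refine add_le_add ?_ ((Set.ncard_insert_le _ _).trans (by rw [Set.ncard_singleton]))
  calc (Set.range Φ).ncard ≤ Nat.card (M.State × I × (I → M.WorkSymbol)) := by
        rw [← Set.image_univ, ← Set.ncard_univ]
        exact Set.ncard_image_le
    _ = _ := by rw [Nat.card_prod, Nat.card_prod, Nat.card_fun, hI, mul_assoc]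

/-! ### Simulation of finite automata -/

/-- The machine that simulates a finite automaton and does not use its working tape. -/
def ofDFA {σ : Type} [Finite σ] (D : DFA α σ) : OnlineTM α where
  State := σ
  WorkSymbol := Unit
  blank := ()
  start := D.start
  accepting := D.accept
  step q x _ := match x with
    | .empty => some (q, (), 0, true)
    | .letter a => some (D.step q a, (), 0, true)
    | .endMark => none

section ofDFA

variable {σ : Type} [Finite σ] (D : DFA α σ)

theorem ofDFA_reaches (t : List (Option α)) (q : σ) :
    Reaches (ofDFA D).next (⟨q, fun _ => (), 0, t⟩ : (ofDFA D).Config)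
      ⟨D.evalFrom q t.reduceOption, fun _ => (), 0, []⟩ := by
  induction t generalizing q with
  | nil => exact Relation.ReflTransGen.refl
  | cons x t ih =>
    rcases x with _ | a
    · refine Relation.ReflTransGen.head ?_ (ih q)
      simp [next, ofDFA, scanned]
      rfl
    · refine Relation.ReflTransGen.head ?_ (ih (D.step q a))
      simp [next, ofDFA, scanned]
      rfl

theorem ofDFA_accepts_iff (t : List (Option α)) :
    (ofDFA D).Accepts t ↔ t.reduceOption ∈ D.accepts := by
  have hend : ∀ q : σ, (ofDFA D).next ⟨q, fun _ => (), 0, []⟩ = none := fun q => by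
    simp [next, ofDFA, scanned]
  refine (accepts_iff_of_reaches (ofDFA_reaches D t D.start)).trans ?_
  constructor
  · rintro ⟨e, he, -, ha⟩
    rcases Relation.ReflTransGen.cases_head he with rfl | ⟨y, hy, -⟩
    · exact ha
    · rw [hend] at hy; cases hy
  · exact fun h => ⟨_, Relation.ReflTransGen.refl, hend _, h⟩

theorem ofDFA_visited (t : List (Option α)) : (ofDFA D).visited t = {0} := by
  refine Set.Subset.antisymm ?_ (by
    rintro _ rfl
    exact ⟨_, Relation.ReflTransGen.refl, rfl⟩)
  rintro z ⟨c, hc, rfl⟩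
  rw [Set.mem_singleton_iff]
  induction hc with
  | refl => rfl
  | @tail d e _ hde ih =>
    rw [Option.mem_def, next, Option.map_eq_some_iff] at hde
    obtain ⟨⟨q, g, m, b⟩, hm, rfl⟩ := hde
    have : m = 0 := by
      simp only [ofDFA] at hm
      split at hm <;> cases hm <;> rfl
    simp [ih, this]

end ofDFA

end OnlineTM

/-! ### Asymptotics of the configuration count -/

theorem eventually_mul_sqrt_add_four_lt (K : ℝ) (hK : 0 ≤ K) :
    ∀ᶠ n : ℕ in Filter.atTop, K * √(n : ℝ) + 4 < n := by
  have h : Filter.Tendsto (fun n : ℕ => √(n : ℝ)) Filter.atTop Filter.atTop :=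
    Real.tendsto_sqrt_atTop.comp tendsto_natCast_atTop_atTop
  filter_upwards [h.eventually_gt_atTop (K + 4)] with n hn
  have hsq : √(n : ℝ) * √(n : ℝ) = n := Real.mul_self_sqrt n.cast_nonneg
  nlinarith

/-- If `s ≤ f n` with `f = o(log)`, then a quantity exponential in `s` is eventually less than
`n`. -/
theorem eventually_exponential_lt {f : ℕ → ℝ}
    (hf : f =o[Filter.atTop] fun n : ℕ => Real.log n) (A G : ℕ) :
    ∀ᶠ n : ℕ in Filter.atTop, ∀ s : ℕ, (s : ℝ) ≤ f n →
      2 * (A * (2 * s + 1) * G ^ (2 * s + 1) + 2) < n := by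
  -- The 4 absorbs `2 * s + 1 ≤ 4 ^ s`, and the 2 keeps `B > 1` even for `G = 0`. The little-o
  -- constant below is chosen so that `B ^ s ≤ √n`.
  set B : ℝ := 4 * (G : ℝ) ^ 2 + 2 with hB
  have hB1 : 1 < B := by nlinarith [sq_nonneg (G : ℝ)]
  have hlogB : 0 < Real.log B := Real.log_pos hB1
  filter_upwards [hf.bound (show 0 < 1 / (2 * Real.log B) by positivity),
    eventually_mul_sqrt_add_four_lt (2 * A * G) (by positivity),
    Filter.eventually_ge_atTop 1] with n hfn hn hn1 s hs
  have hn1' : (1 : ℝ) ≤ n := by exact_mod_cast hn1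
  have hlog : 0 ≤ Real.log n := Real.log_nonneg hn1'
  rw [Real.norm_eq_abs, Real.norm_eq_abs, abs_of_nonneg hlog] at hfn
  have hsB : s * Real.log B ≤ Real.log n / 2 := by
    have h := hs.trans ((le_abs_self _).trans hfn)
    calc s * Real.log B ≤ 1 / (2 * Real.log B) * Real.log n * Real.log B := by gcongr
      _ = Real.log n / 2 := by field_simp
  have hpow : B ^ s ≤ √(n : ℝ) := by
    rw [← Real.log_le_log_iff (by positivity) (by positivity), Real.log_pow,
      Real.log_sqrt n.cast_nonneg]
    exact hsB
  have hbern : (2 * s + 1 : ℝ) ≤ 4 ^ s := by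
    have h := one_add_mul_le_pow (show (-2 : ℝ) ≤ 3 by norm_num) s
    norm_num at h
    have : (0 : ℝ) ≤ s := s.cast_nonneg
    linarith
  have hGB : (4 : ℝ) ^ s * ((G : ℝ) ^ 2) ^ s ≤ B ^ s := by
    rw [← mul_pow]
    exact pow_le_pow_left₀ (by positivity) (by linarith) s
  have hmain : (2 * (A * (2 * s + 1) * G ^ (2 * s + 1) + 2) : ℝ) < n := by
    calc (2 * (A * (2 * s + 1) * G ^ (2 * s + 1) + 2) : ℝ)
        = 2 * A * G * ((2 * s + 1) * ((G : ℝ) ^ 2) ^ s) + 4 := by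
          rw [pow_succ, pow_mul]; ring
      _ ≤ 2 * A * G * √(n : ℝ) + 4 := by
          gcongr
          exact (mul_le_mul_of_nonneg_right hbern (by positivity)).trans (hGB.trans hpow)
      _ < n := hn
  exact_mod_cast hmain

/-! ### The two inclusions -/

theorem OnlineTM.shiftedQuotient_mem_boundedLanguages {α : Type*} [Nonempty α] {M : OnlineTM α}
    {n : ℕ} {r : ℝ}
    (hM : ∀ w : List α, w.length = n → M.UsesAtMost (shiftedInput w) r) :
    (∀ u : List α, u.length ≤ n → M.tapeLanguage.shiftedQuotient n u ∈ M.boundedLanguages ⌊r⌋₊) ∧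
      ∀ k ≤ n, M.tapeLanguage.shiftedQuotient k [] ∈ M.boundedLanguages ⌊r⌋₊ := by
  obtain ⟨a⟩ := ‹Nonempty α›
  have key : ∀ (t v : List (Option α)) (w : List α), w.length = n → shiftedInput w = t ++ v →
      M.tapeLanguage.leftQuotient t ∈ M.boundedLanguages ⌊r⌋₊ := by
    intro t v w hw htv
    obtain ⟨hfin, hcard⟩ := hM w hw
    rw [htv] at hfin hcard
    exact M.boundedLanguages_mono (Nat.le_floor hcard) (leftQuotient_mem_boundedLanguages hfin)
  constructor
  · intro u hu
    -- Padding with a letter makes the prefix part of a genuine shifted input of length `n`.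
    have hlen : (u ++ List.replicate (n - u.length) a).length = n := by simp; omega
    refine key _ ((List.replicate (n - u.length) a).map some) _ hlen ?_
    rw [shiftedInput, hlen, List.map_append, List.append_assoc]
  · intro k hk
    refine key _ (List.replicate (n - k) none ++ (List.replicate n a).map some)
      (List.replicate n a) (by simp) ?_
    rw [shiftedInput, List.length_replicate, List.map_nil, List.append_nil, ← List.append_assoc,
      List.replicate_append_replicate, Nat.add_sub_cancel' hk]

theorem OneDSpaceShiftedLittleO.isRegular {α : Type*} [Finite α] {L : Language α}
    (hL : L ∈ OneDSpaceShiftedLittleO α fun n => Real.log n) : L.IsRegular := by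
  obtain ⟨f, hf, M, hM⟩ := hL
  -- Without letters there are no words of positive length to pad with, but then there are only
  -- finitely many languages.
  rcases isEmpty_or_nonempty α with hα | hα
  · have : Finite (Language α) := inferInstanceAs (Finite (Set (List α)))
    exact Language.isRegular_iff_finite_range_leftQuotient.2 (Set.toFinite _)
  obtain ⟨n₀, hn₀⟩ := Filter.eventually_atTop.1
    (eventually_exponential_lt hf (Nat.card M.State) (Nat.card M.WorkSymbol))
  refine Language.isRegular_of_finite_shiftedQuotient (T := M.tapeLanguage)
    (fun w => (hM w).1) (Language.finite_setOf_shiftedQuotient (n₀ := n₀) fun n hn => ?_)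
  have huse : ∀ w : List α, w.length = n → M.UsesAtMost (shiftedInput w) (f n) :=
    fun w hw => hw ▸ (hM w).2
  have hnonneg : 0 ≤ f n := by
    obtain ⟨a⟩ := hα
    exact (Nat.cast_nonneg _).trans (huse (List.replicate n a) (by simp)).2
  obtain ⟨hfin, hcard⟩ := M.boundedLanguages_finite_ncard_le ⌊f n⌋₊
  have hlt := hn₀ n hn ⌊f n⌋₊ (Nat.floor_le hnonneg)
  exact ⟨_, hfin, by omega, OnlineTM.shiftedQuotient_mem_boundedLanguages huse⟩

theorem Language.IsRegular.mem_oneDSpaceShiftedLittleO {α : Type*} {L : Language α}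
    (hL : L.IsRegular) : L ∈ OneDSpaceShiftedLittleO α fun n => Real.log n := by
  obtain ⟨σ, _, D, rfl⟩ := hL
  refine ⟨fun _ => 1, Real.isLittleO_const_log_atTop.comp_tendsto tendsto_natCast_atTop_atTop,
    OnlineTM.ofDFA D, fun w => ⟨?_, ?_⟩⟩
  · have h : (shiftedInput w).reduceOption = w := by
      simp [shiftedInput, List.reduceOption_append, List.reduceOption_replicate_none]
      simp [List.reduceOption]
    rw [OnlineTM.ofDFA_accepts_iff, h]
  · rw [OnlineTM.UsesAtMost, OnlineTM.ofDFA_visited]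
    simp

theorem mainTheorem7 {α : Type*} [Finite α] :
    OneDSpaceShiftedLittleO α (fun n => Real.log n) = {L : Language α | L.IsRegular} :=
  Set.Subset.antisymm (fun _ hL => OneDSpaceShiftedLittleO.isRegular hL)
    fun _ hL => Language.IsRegular.mem_oneDSpaceShiftedLittleO hL
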